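/- Let $A$ and $B$ be torsionfree nilpotent groups, and let $C$ be an abelian group embedded as a subgroup in both $A$ and $B$. Suppose that $C$ is a retract of $A$ and of $B$, i.e. there are homomorphisms $A \to C$ and $B \to C$ whose restrictions to $C$ are the identity. Then the free amalgamated product $A *_C B$ is residually nilpotent: every nontrivial element of $A *_C B$ has nontrivial image in some nilpotent quotient of $A *_C B$. -/

import Mathlib

namespace FreeAmalgam

/-- A group is torsionfree if its only element of finite order is the identity.
(Mathlib's `IsMulTorsionFree` asks for injectivity of the power maps, which is a priori stronger
for noncommutative groups.) -/
def IsTorsionfree (G : Type*) [Group G] : Prop :=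
  ∀ g : G, IsOfFinOrder g → g = 1

/-- A subgroup `H` of `G` is a retract if some homomorphism `G → H` restricts to the identity
on `H`. -/
def IsRetract {G : Type*} [Group G] (H : Subgroup G) : Prop :=
  ∃ φ : G →* H, ∀ h : H, φ (h : G) = h

/-- A group is residually nilpotent if every nontrivial element has nontrivial image in some
nilpotent quotient. -/
def IsResiduallyNilpotent (G : Type*) [Group G] : Prop :=
  ∀ g : G, g ≠ 1 → ∃ (N : Subgroup G) (_ : N.Normal),
    Group.IsNilpotent (G ⧸ N) ∧ (QuotientGroup.mk' N g) ≠ 1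

/-- The relators `i(c) j(c)⁻¹`, for `c : C`, in the free product `A * B`. -/
def amalgamRelators {A B C : Type*} [Group A] [Group B] [Group C] (i : C →* A) (j : C →* B) :
    Set (Monoid.Coprod A B) :=
  Set.range fun c : C => Monoid.Coprod.inl (i c) * (Monoid.Coprod.inr (j c))⁻¹

/-- The free product of `A` and `B` amalgamated along `i : C → A` and `j : C → B`: the quotient
of the free product `A * B` by the normal closure of the elements `i(c) j(c)⁻¹`. -/
abbrev AmalgamatedProduct {A B C : Type*} [Group A] [Group B] [Group C]
    (i : C →* A) (j : C →* B) : Type _ :=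
  Monoid.Coprod A B ⧸ Subgroup.normalClosure (amalgamRelators i j)

end FreeAmalgam

/-! Write G = A *_C B. The two retractions agree on C, so they glue to a retraction r : G → C. Every
g in G is an alternating word in letters from A \ C and B \ C, followed by some c in C. If the word
is empty, r detects g. Otherwise a unipotent rational representation of G detects it, and the image
of such a representation is nilpotent (`IsUnipotent.isNilpotent_quotient_ker`). Uniqueness of normal
forms is never needed.

The representation is built one letter at a time, from the right (`Detects.cons`). To prepend s in A
\ C to a word detected on V by p : V → X, let G act on V × (U ⊗ X), where U is a unipotent
representation of A with a vector e whose stabilizer is C. B acts diagonally, through r on U ⊗ X; A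
acts with an extra cocycle (a e - e) ⊗ r(a) p(v), which vanishes on C. The actions agree on C, hence
glue. The new coordinate stays 0 until s is applied, and is then a nonzero tensor.

U comes from the group ring (`exists_isUnipotent_of_retraction`): for the idempotent σ : A → C ⊆ A,
let a act on ℚ[A] by y ↦ a y σ(a)⁻¹, modulo a deep term of a weighted augmentation filtration. Then
a fixes 1 exactly when a σ(a)⁻¹ lies in a deep rational dimension subgroup, and this is trivial for
torsionfree nilpotent A (`dimTrivial_upperCentralSeries`). The latter is proved by climbing the
upper central series through infinite cyclic extensions. -/

namespace FreeAmalgam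

open scoped commutatorElement

/-! ### Weighted augmentation filtrations of rational group rings. -/

section GroupRing

variable {A : Type*} [Group A]

/-- The basis element of the rational group ring attached to a group element. -/
noncomputable def gr : A →* MonoidAlgebra ℚ A := MonoidAlgebra.of ℚ A

lemma gr_mul_sub_one_mul (h g : A) (y : MonoidAlgebra ℚ A) :
    gr h * ((gr g - 1) * y) = gr (h * g) * y - gr h * y := by
  rw [map_mul]; simp only [sub_mul, mul_sub, one_mul, mul_assoc]

/-- The linear extension of a function on a group to its rational group ring. -/
noncomputable def linExt {V : Type*} [AddCommGroup V] [Module ℚ V] (f : A → V) :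
    MonoidAlgebra ℚ A →ₗ[ℚ] V :=
  Finsupp.linearCombination ℚ f ∘ₗ (MonoidAlgebra.coeffLinearEquiv ℚ).toLinearMap

@[simp] lemma linExt_gr {V : Type*} [AddCommGroup V] [Module ℚ V] (f : A → V) (a : A) :
    linExt f (gr a) = f a := by
  have : (MonoidAlgebra.coeffLinearEquiv ℚ) (gr a) = Finsupp.single a (1 : ℚ) := rfl
  simp [linExt, this]

lemma linExt_one {V : Type*} [AddCommGroup V] [Module ℚ V] (f : A → V) :
    linExt f (1 : MonoidAlgebra ℚ A) = f 1 := by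
  rw [← map_one gr, linExt_gr]

/-- A filtration of a group by normal subgroups, compatible with commutators. -/
structure IsNSeries (D : ℕ → Subgroup A) : Prop where
  normal : ∀ i, (D i).Normal
  anti : Antitone D
  one : D 1 = ⊤
  comm : ∀ {i j : ℕ} {x y : A}, x ∈ D i → y ∈ D j → ⁅x, y⁆ ∈ D (i + j)

lemma IsNSeries.mem_zero {D : ℕ → Subgroup A} (hD : IsNSeries D) (a : A) : a ∈ D 0 :=
  hD.anti zero_le_one (hD.one ▸ Subgroup.mem_top a)

/-- Products `(h₁ - 1) ⋯ (hᵣ - 1)` with `hᵢ ∈ H`, of total weight `n` for the filtration `D`. -/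
inductive AugProd (D : ℕ → Subgroup A) (H : Subgroup A) : ℕ → MonoidAlgebra ℚ A → Prop
  | one : AugProd D H 0 1
  | cons {h : A} {i n : ℕ} {y : MonoidAlgebra ℚ A} :
      h ∈ H → h ∈ D i → AugProd D H n y → AugProd D H (n + i) ((gr h - 1) * y)

/-- The part of weight at least `k` of the group ring of `H`. -/
noncomputable def augFilt (D : ℕ → Subgroup A) (H : Subgroup A) (k : ℕ) :
    Submodule ℚ (MonoidAlgebra ℚ A) :=
  Submodule.span ℚ {y | ∃ n, k ≤ n ∧ AugProd D H n y}

variable {D : ℕ → Subgroup A} {H B : Subgroup A}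

lemma AugProd.mem_augFilt {n : ℕ} {y : MonoidAlgebra ℚ A} (h : AugProd D H n y) :
    y ∈ augFilt D H n :=
  Submodule.subset_span ⟨n, le_rfl, h⟩

lemma augFilt_antitone : Antitone (augFilt D H) := fun _ _ hkl =>
  Submodule.span_mono fun _ ⟨n, hn, hy⟩ => ⟨n, hkl.trans hn, hy⟩

lemma AugProd.mono (hBH : B ≤ H) {n : ℕ} {y : MonoidAlgebra ℚ A} (h : AugProd D B n y) :
    AugProd D H n y := by
  induction h with
  | one => exact .one
  | cons hb hi _ ih => exact .cons (hBH hb) hi ih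

lemma augFilt_mono (hBH : B ≤ H) (k : ℕ) : augFilt D B k ≤ augFilt D H k :=
  Submodule.span_mono fun _ ⟨n, hn, hy⟩ => ⟨n, hn, hy.mono hBH⟩

/-- To check that a linear map sends `augFilt D H k` into a submodule, test products. -/
lemma augFilt_le_comap {V : Type*} [AddCommGroup V] [Module ℚ V]
    (f : MonoidAlgebra ℚ A →ₗ[ℚ] V) (W : Submodule ℚ V) {k : ℕ}
    (h : ∀ n y, k ≤ n → AugProd D H n y → f y ∈ W) {y : MonoidAlgebra ℚ A}
    (hy : y ∈ augFilt D H k) : f y ∈ W := by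
  have : augFilt D H k ≤ W.comap f :=
    Submodule.span_le.2 fun y ⟨n, hn, hy⟩ => h n y hn hy
  exact this hy

lemma sub_one_mul_mem_augFilt {h : A} {i k : ℕ} {y : MonoidAlgebra ℚ A}
    (hH : h ∈ H) (hi : h ∈ D i) (hy : y ∈ augFilt D H k) :
    (gr h - 1) * y ∈ augFilt D H (k + i) :=
  augFilt_le_comap (LinearMap.mulLeft ℚ (gr h - 1)) _
    (fun n _ hn hy => augFilt_antitone (by omega) (AugProd.cons hH hi hy).mem_augFilt) hy

lemma gr_mul_mem_augFilt (hD : IsNSeries D) {h : A} {k : ℕ} {y : MonoidAlgebra ℚ A}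
    (hH : h ∈ H) (hy : y ∈ augFilt D H k) : gr h * y ∈ augFilt D H k := by
  have := add_mem (sub_one_mul_mem_augFilt (i := 0) hH (hD.mem_zero h) hy) hy
  simpa [sub_mul] using this

lemma augFilt_zero_top (hD : IsNSeries D) : augFilt D (⊤ : Subgroup A) 0 = ⊤ := by
  rw [eq_top_iff, ← (MonoidAlgebra.basis A ℚ).span_eq, Submodule.span_le]
  rintro _ ⟨a, rfl⟩
  have := gr_mul_mem_augFilt hD (Subgroup.mem_top a) (AugProd.one (D := D) (H := ⊤)).mem_augFilt
  rwa [mul_one] at this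

/-- Leibniz rule for conjugation: s h s⁻¹ = ⁅s, h⁆ h, and ⁅s, h⁆ has the sum of the weights of s and
h, so replacing each factor of a product by its conjugate gains the weight of s. -/
lemma AugProd.conj_sub_mem (hD : IsNSeries D) {s : A} {i n : ℕ} {y : MonoidAlgebra ℚ A}
    (hs : s ∈ D i) (hn : ∀ b ∈ H, s * b * s⁻¹ ∈ H) (hy : AugProd D H n y) :
    gr s * y * gr s⁻¹ - y ∈ augFilt D H (n + i) := by
  induction hy with
  | one => simp [← map_mul]
  | @cons h j n y hh hj hy ih =>
    have hc : ⁅s, h⁆ ∈ H := by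
      rw [commutatorElement_def]; exact mul_mem (hn h hh) (inv_mem hh)
    have hy' : gr s * y * gr s⁻¹ ∈ augFilt D H n := by
      have := add_mem (augFilt_antitone (Nat.le_add_right n i) ih) hy.mem_augFilt
      simpa using this
    have h1 := sub_one_mul_mem_augFilt hc (hD.comm hs hj) (gr_mul_mem_augFilt hD hh hy')
    have h2 := sub_one_mul_mem_augFilt hh hj ih
    have e1 : gr ⁅s, h⁆ * gr h = gr s * gr h * gr s⁻¹ := by
      simp only [← map_mul, commutatorElement_def]; congr 1; group
    have e2 : gr s⁻¹ * gr s = (1 : MonoidAlgebra ℚ A) := by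
      simp [← map_mul]
    have e3 : gr s * gr s⁻¹ = (1 : MonoidAlgebra ℚ A) := by
      simp [← map_mul]
    have key : gr s * ((gr h - 1) * y) * gr s⁻¹ - (gr h - 1) * y
        = (gr ⁅s, h⁆ - 1) * (gr h * (gr s * y * gr s⁻¹))
          + (gr h - 1) * (gr s * y * gr s⁻¹ - y) := by
      have : gr s * gr h * y = gr s * gr h * (gr s⁻¹ * gr s) * y := by rw [e2, mul_one]
      rw [sub_mul (gr ⁅s, h⁆), ← mul_assoc (gr ⁅s, h⁆), e1]
      simp only [mul_sub, sub_mul, one_mul, ← mul_assoc] at this ⊢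
      rw [this]; abel
    rw [key]
    refine add_mem (augFilt_antitone ?_ h1) (augFilt_antitone ?_ h2) <;> omega

/-- Twisted translation `y ↦ b s y s⁻¹` raises weights. -/
lemma twist_sub_mem_augFilt (hD : IsNSeries D) {b s : A} {i k : ℕ} {y : MonoidAlgebra ℚ A}
    (hb : b ∈ H) (hbi : b ∈ D i) (hs : s ∈ D i) (hn : ∀ b ∈ H, s * b * s⁻¹ ∈ H)
    (hy : y ∈ augFilt D H k) :
    gr (b * s) * y * gr s⁻¹ - y ∈ augFilt D H (k + i) := by
  have h1 : gr s * y * gr s⁻¹ - y ∈ augFilt D H (k + i) :=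
    augFilt_le_comap (LinearMap.mulRight ℚ (gr s⁻¹) ∘ₗ LinearMap.mulLeft ℚ (gr s) - LinearMap.id)
      _ (fun n _ hn' hy => augFilt_antitone (by omega) (hy.conj_sub_mem hD hs hn)) hy
  have h2 : gr s * y * gr s⁻¹ ∈ augFilt D H k := by
    simpa using add_mem (augFilt_antitone (Nat.le_add_right k i) h1) hy
  have h3 := add_mem (sub_one_mul_mem_augFilt hb hbi h2) h1
  have e : gr (b * s) * y * gr s⁻¹ - y
      = (gr b - 1) * (gr s * y * gr s⁻¹) + (gr s * y * gr s⁻¹ - y) := by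
    rw [map_mul]; simp only [sub_mul, one_mul, ← mul_assoc]; abel
  rwa [e]

/-- Membership in `augFilt D H k` is witnessed by finitely many elements of `H`. -/
lemma exists_finset_mem_augFilt {k : ℕ} {y : MonoidAlgebra ℚ A} (hy : y ∈ augFilt D H k) :
    ∃ S : Set A, S.Finite ∧ S ⊆ H ∧ y ∈ augFilt D (Subgroup.closure S) k := by
  have hprod : ∀ {n : ℕ} {y : MonoidAlgebra ℚ A}, AugProd D H n y →
      ∃ S : Set A, S.Finite ∧ S ⊆ H ∧ AugProd D (Subgroup.closure S) n y := by
    intro n y hy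
    induction hy with
    | one => exact ⟨∅, Set.finite_empty, Set.empty_subset _, .one⟩
    | @cons h i n y hh hi _ ih =>
      obtain ⟨S, hS, hSH, hy⟩ := ih
      refine ⟨insert h S, hS.insert h, Set.insert_subset hh hSH, .cons ?_ hi (hy.mono ?_)⟩
      · exact Subgroup.subset_closure (Set.mem_insert _ _)
      · exact Subgroup.closure_mono (Set.subset_insert _ _)
  induction hy using Submodule.span_induction with
  | mem y hy =>
    obtain ⟨n, hn, hy⟩ := hy
    obtain ⟨S, hS, hSH, hy⟩ := hprod hy
    exact ⟨S, hS, hSH, augFilt_antitone hn hy.mem_augFilt⟩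
  | zero => exact ⟨∅, Set.finite_empty, Set.empty_subset _, zero_mem _⟩
  | add y z _ _ hy hz =>
    obtain ⟨S, hS, hSH, hy⟩ := hy
    obtain ⟨T, hT, hTH, hz⟩ := hz
    exact ⟨S ∪ T, hS.union hT, Set.union_subset hSH hTH,
      add_mem (augFilt_mono (Subgroup.closure_mono Set.subset_union_left) k hy)
        (augFilt_mono (Subgroup.closure_mono Set.subset_union_right) k hz)⟩
  | smul c y _ hy =>
    obtain ⟨S, hS, hSH, hy⟩ := hy
    exact ⟨S, hS, hSH, Submodule.smul_mem _ c hy⟩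

/-- `H` meets the dimension subgroup of level `N` trivially. -/
def DimTrivial (D : ℕ → Subgroup A) (N : ℕ) (H : Subgroup A) : Prop :=
  ∀ m ∈ H, gr m - 1 ∈ augFilt D H N → m = 1

/-- A twisting function `t`, defined on `H` and trivial on `B`, transports the filtration of the
group ring of `H` to that of `B`. -/
lemma linExt_twist_mem_augFilt (hD : IsNSeries D) (t : A → A)
    (t_mul : ∀ g ∈ H, ∀ h ∈ H, t (g * h) = t g * t h)
    (t_norm : ∀ h ∈ H, ∀ b ∈ B, t h * b * (t h)⁻¹ ∈ B)
    (t_sub : ∀ h ∈ H, h * (t h)⁻¹ ∈ B)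
    (t_wt : ∀ i, ∀ h ∈ H, h ∈ D i → t h ∈ D i)
    {k : ℕ} {y : MonoidAlgebra ℚ A} (hy : y ∈ augFilt D H k) :
    linExt (fun a => gr (a * (t a)⁻¹)) y ∈ augFilt D B k := by
  set Φ := linExt (fun a : A => gr (a * (t a)⁻¹)) with hΦ
  -- Φ intertwines left translation by h with y ↦ h y t(h)⁻¹. Factoring g = b t(g) with b in B then
  -- makes Φ((g - 1) y) a twisted difference, which `twist_sub_mem_augFilt` controls.
  have hequiv : ∀ {n y}, AugProd D H n y →
      ∀ h ∈ H, Φ (gr h * y) = gr h * Φ y * gr (t h)⁻¹ := by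
    intro n y hy
    induction hy with
    | one =>
      intro h _
      have ht1 : t 1 = 1 := by simpa using t_mul 1 H.one_mem 1 H.one_mem
      rw [mul_one, hΦ, linExt_one, linExt_gr, ht1, map_mul]
      simp
    | @cons g i n y hg _ _ ih =>
      intro h hh
      rw [gr_mul_sub_one_mul, map_sub, ih _ (mul_mem hh hg), ih h hh, sub_mul, one_mul, map_sub, ih g hg,
        t_mul h hh g hg, mul_inv_rev]
      simp only [map_mul, mul_sub, sub_mul, mul_assoc]
  refine augFilt_le_comap Φ _ (fun n y hn hy => augFilt_antitone hn ?_) hy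
  clear hn
  induction hy with
  | one =>
    have ht1 : t 1 = 1 := by simpa using t_mul 1 H.one_mem 1 H.one_mem
    rw [hΦ, linExt_one, ht1, inv_one, mul_one, map_one]
    exact AugProd.one.mem_augFilt
  | @cons g i n y hg hi hy ih =>
    have := twist_sub_mem_augFilt hD (t_sub g hg)
      (mul_mem hi (inv_mem (t_wt i g hg hi))) (t_wt i g hg hi) (t_norm g hg) ih
    rw [inv_mul_cancel_right] at this
    rwa [sub_mul, one_mul, map_sub, hequiv hy g hg]

/-- The transport map fixes m - 1 when t(m) = 1, so the hypothesis on B applies to it directly. -/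
lemma DimTrivial.of_twist (hD : IsNSeries D) {N : ℕ} (t : A → A) (hB : DimTrivial D N B)
    (t_mul : ∀ g ∈ H, ∀ h ∈ H, t (g * h) = t g * t h)
    (t_norm : ∀ h ∈ H, ∀ b ∈ B, t h * b * (t h)⁻¹ ∈ B)
    (t_sub : ∀ h ∈ H, h * (t h)⁻¹ ∈ B)
    (t_wt : ∀ i, ∀ h ∈ H, h ∈ D i → t h ∈ D i)
    {m : A} (hm : m ∈ B) (tm : t m = 1) (h : gr m - 1 ∈ augFilt D H N) : m = 1 := by
  have key := linExt_twist_mem_augFilt hD t t_mul t_norm t_sub t_wt h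
  have ht1 : t 1 = 1 := by simpa using t_mul 1 H.one_mem 1 H.one_mem
  rw [map_sub, linExt_gr, linExt_one, tm, ht1, inv_one, mul_one, mul_one, map_one] at key
  exact hB m hm key

/-- Additive functions on `H` vanish on the dimension subgroups of positive level. -/
lemma eq_zero_of_sub_one_mem_augFilt {N : ℕ} (hDN : D N = ⊥) (hD : IsNSeries D)
    (f : A → ℚ) (f_mul : ∀ g ∈ H, ∀ h ∈ H, f (g * h) = f g + f h)
    {m : A} (h : gr m - 1 ∈ augFilt D H N) : f m = 0 := by
  have f1 : f 1 = 0 := by simpa using f_mul 1 H.one_mem 1 H.one_mem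
  have p1 : linExt f 1 = 0 := by rw [linExt_one, f1]
  have e1 : linExt (fun _ : A => (1 : ℚ)) 1 = 1 := linExt_one _
  have hε : ∀ {n y}, AugProd D H n y → ∀ h ∈ H,
      linExt (fun _ : A => (1 : ℚ)) (gr h * y) = linExt (fun _ : A => (1 : ℚ)) y := by
    intro n y hy
    induction hy with
    | one => intro h _; rw [mul_one, linExt_gr, e1]
    | @cons g i n y hg _ _ ih =>
      intro h hh
      rw [gr_mul_sub_one_mul, map_sub, ih _ (mul_mem hh hg), ih h hh, sub_mul, one_mul, map_sub, ih g hg]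
  -- With ε the augmentation, f((h - 1) y) = f(h) ε(y). This kills products of two or more factors,
  -- and a single factor of weight at least N has h = 1.
  have hψ : ∀ {n y}, AugProd D H n y → ∀ h ∈ H,
      linExt f (gr h * y) = f h * linExt (fun _ : A => (1 : ℚ)) y + linExt f y := by
    intro n y hy
    induction hy with
    | one => intro h _; rw [mul_one, linExt_gr, e1, p1]; ring
    | @cons g i n y hg _ hy ih =>
      intro h hh
      rw [gr_mul_sub_one_mul, map_sub, ih _ (mul_mem hh hg), ih h hh, sub_mul, one_mul, map_sub, map_sub,
        ih g hg, hε hy g hg, f_mul h hh g hg]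
      ring
  have key : linExt f (gr m - 1) ∈ (⊥ : Submodule ℚ ℚ) := by
    refine augFilt_le_comap _ _ (fun n y hn hy => ?_) h
    rw [Submodule.mem_bot]
    cases hy with
    | one => exact p1
    | @cons g i n y hg hi hy =>
      rw [sub_mul, one_mul, map_sub, hψ hy g hg, add_sub_cancel_right]
      cases hy with
      | one =>
        have : g ∈ D N := hD.anti (by omega) hi
        rw [hDN, Subgroup.mem_bot] at this
        rw [this, f1, zero_mul]
      | @cons g' i n y hg' hi hy =>
        rw [sub_mul, one_mul, map_sub, hε hy g' hg', sub_self, mul_zero]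
  rw [Submodule.mem_bot, map_sub, linExt_gr, p1, sub_zero] at key
  exact key

end GroupRing

/-! ### Infinite cyclic and free abelian extensions. -/

section Extension

variable {A : Type*} [Group A] {D : ℕ → Subgroup A}

/-- Triviality of dimension subgroups passes to extensions by an infinite cyclic group. -/
lemma DimTrivial.of_int {N : ℕ} (hD : IsNSeries D) (hDN : D N = ⊥) {B H : Subgroup A}
    (f : A → ℤ) (f_mul : ∀ g ∈ H, ∀ h ∈ H, f (g * h) = f g + f h)
    {x : A} (hx : x ∈ H) (fx : f x = 1) (hB : ∀ a, a ∈ B ↔ a ∈ H ∧ f a = 0)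
    (hwt : ∀ i, H ≤ D i ∨ ∀ h ∈ H, h ∈ D i → f h = 0)
    (h : DimTrivial D N B) : DimTrivial D N H := by
  intro m hm hmN
  have fm : f m = 0 := by
    have := eq_zero_of_sub_one_mem_augFilt hDN hD (fun a => (f a : ℚ))
      (fun g hg h hh => by rw [f_mul g hg h hh, Int.cast_add]) hmN
    exact_mod_cast this
  have f1 : f 1 = 0 := by simpa using f_mul 1 H.one_mem 1 H.one_mem
  have finv : ∀ g ∈ H, f g⁻¹ = - f g := fun g hg => by
    have := f_mul g hg g⁻¹ (inv_mem hg)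
    rw [mul_inv_cancel, f1] at this; omega
  have fpow : ∀ k : ℤ, f (x ^ k) = k := by
    have : ∀ k : ℕ, f (x ^ k) = k := fun k => by
      induction k with
      | zero => simpa using f1
      | succ k ih => rw [pow_succ, f_mul _ (pow_mem hx k) _ hx, ih, fx]; push_cast; rfl
    intro k
    obtain ⟨n, rfl | rfl⟩ := k.eq_nat_or_neg
    · simpa using this n
    · rw [zpow_neg, zpow_natCast, finv _ (pow_mem hx n), this]
  have hxk : ∀ k : ℤ, x ^ k ∈ H := fun k => zpow_mem hx k
  -- The element x splits H → ℤ, and the twist is the resulting endomorphism of H with kernel B.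
  refine h.of_twist hD (fun a => x ^ f a) ?_ ?_ ?_ ?_ ((hB m).2 ⟨hm, fm⟩) (by simp [fm]) hmN
  · intro g hg h hh
    rw [f_mul g hg h hh, zpow_add]
  · intro h _ b hb
    rw [hB] at hb ⊢
    have hc := inv_mem (hxk (f h))
    refine ⟨mul_mem (mul_mem (hxk _) hb.1) hc, ?_⟩
    rw [f_mul _ (mul_mem (hxk _) hb.1) _ hc, f_mul _ (hxk _) _ hb.1, finv _ (hxk _), hb.2]
    omega
  · intro h hh
    have hc := inv_mem (hxk (f h))
    refine (hB _).2 ⟨mul_mem hh hc, ?_⟩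
    rw [f_mul _ hh _ hc, finv _ (hxk _), fpow]
    omega
  · intro i h hh hhi
    rcases hwt i with hi | hi
    · exact hi (hxk _)
    · simp [hi h hh hhi]

/-- Triviality of dimension subgroups passes to extensions by a free abelian group of finite
rank. -/
lemma DimTrivial.of_free {N : ℕ} (hD : IsNSeries D) (hDN : D N = ⊥) {B : Subgroup A}
    (h : DimTrivial D N B) :
    ∀ (n : ℕ) (H : Subgroup A) (f : A → Fin n → ℤ),
      (∀ g ∈ H, ∀ h ∈ H, f (g * h) = f g + f h) → (∀ v, ∃ h ∈ H, f h = v) →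
      (∀ a, a ∈ B ↔ a ∈ H ∧ f a = 0) → (∀ i, H ≤ D i ∨ ∀ h ∈ H, h ∈ D i → f h = 0) →
      DimTrivial D N H := by
  intro n
  induction n with
  | zero =>
    intro H f _ _ hB _ m hm
    have hBH : H ≤ B := fun a ha => (hB a).2 ⟨ha, Subsingleton.elim _ _⟩
    exact fun hmN => h m (hBH hm) (augFilt_mono hBH N hmN)
  | succ n ih =>
    intro H f f_mul f_surj hB hwt
    have f1 : f 1 = 0 := by simpa using f_mul 1 H.one_mem 1 H.one_mem
    have finv : ∀ g ∈ H, f g⁻¹ = - f g := fun g hg => by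
      have := f_mul g hg g⁻¹ (inv_mem hg)
      rw [mul_inv_cancel, f1] at this
      exact (neg_eq_of_add_eq_zero_right this.symm).symm
    -- K is the kernel of the first coordinate: K/B has rank n, and H/K is infinite cyclic.
    let K : Subgroup A :=
      { carrier := {a | a ∈ H ∧ f a 0 = 0}
        one_mem' := ⟨H.one_mem, by simp [f1]⟩
        mul_mem' := fun {a b} ha hb => ⟨mul_mem ha.1 hb.1, by
          rw [f_mul a ha.1 b hb.1, Pi.add_apply, ha.2, hb.2, add_zero]⟩
        inv_mem' := fun {a} ha => ⟨inv_mem ha.1, by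
          rw [finv a ha.1, Pi.neg_apply, ha.2, neg_zero]⟩ }
    have hK : DimTrivial D N K := by
      refine ih K (fun a => Fin.tail (f a)) ?_ ?_ ?_ ?_
      · intro g hg h hh
        simp only [f_mul g hg.1 h hh.1]; rfl
      · intro v
        obtain ⟨a, ha, hav⟩ := f_surj (Fin.cons 0 v)
        exact ⟨a, ⟨ha, by rw [hav, Fin.cons_zero]⟩, by simp [hav]⟩
      · intro a
        rw [hB]
        constructor
        · rintro ⟨ha, h0⟩
          refine ⟨⟨ha, by rw [h0]; rfl⟩, by rw [h0]; rfl⟩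
        · rintro ⟨⟨ha, h0⟩, h1⟩
          refine ⟨ha, ?_⟩
          rw [← Fin.cons_self_tail (f a), h0, h1]
          funext i
          refine Fin.cases ?_ (fun i => ?_) i <;> simp
      · intro i
        rcases hwt i with hi | hi
        · exact Or.inl fun a ha => hi ha.1
        · exact Or.inr fun a ha hai => by rw [hi a ha.1 hai]; rfl
    obtain ⟨x, hx, fx⟩ := f_surj (fun _ => 1)
    refine hK.of_int hD hDN (fun a => f a 0) ?_ hx (by rw [fx]) (fun a => Iff.rfl) ?_
    · intro g hg h hh
      simp only [f_mul g hg h hh]; rfl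
    · intro i
      rcases hwt i with hi | hi
      · exact Or.inl hi
      · exact Or.inr fun a ha hai => by rw [hi a ha hai]; rfl

end Extension

/-! ### Upper central series and triviality of deep dimension subgroups. -/

section UpperCentral

variable {A : Type*} [Group A]

/-- Modulo K the commutator is central, so x ↦ ⁅x, y⁆ is multiplicative on powers of x. -/
lemma commutator_pow_mul_inv_mem {K : Subgroup A} [K.Normal] {x y : A}
    (hc : ∀ z, ⁅⁅x, y⁆, z⁆ ∈ K) (n : ℕ) : ⁅x ^ n, y⁆ * (⁅x, y⁆ ^ n)⁻¹ ∈ K := by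
  have key : ∀ n : ℕ, ((⁅x ^ n, y⁆ : A) : A ⧸ K) = ((⁅x, y⁆ ^ n : A) : A ⧸ K) := by
    have hcomm : ∀ z : A, ((⁅x, y⁆ : A) : A ⧸ K) * (z : A ⧸ K) = z * ((⁅x, y⁆ : A) : A ⧸ K) := by
      intro z
      have := (QuotientGroup.eq_one_iff (N := K) _).2 (hc z)
      rw [commutatorElement_def] at this
      rw [QuotientGroup.mk_mul, QuotientGroup.mk_mul, QuotientGroup.mk_mul, QuotientGroup.mk_inv,
        QuotientGroup.mk_inv] at this
      rwa [mul_inv_eq_one, mul_inv_eq_iff_eq_mul] at this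
    intro n
    induction n with
    | zero => simp
    | succ n ih =>
      have e : ⁅x ^ (n + 1), y⁆ = x * ⁅x ^ n, y⁆ * x⁻¹ * ⁅x, y⁆ := by
        simp only [commutatorElement_def, pow_succ']; group
      have hpow : ((⁅x, y⁆ ^ n : A) : A ⧸ K) * (x : A ⧸ K) = x * ((⁅x, y⁆ ^ n : A) : A ⧸ K) := by
        have : Commute ((⁅x, y⁆ : A) : A ⧸ K) (x : A ⧸ K) := hcomm x
        have := this.pow_left n
        simpa using this.eq
      rw [e, QuotientGroup.mk_mul, QuotientGroup.mk_mul, QuotientGroup.mk_mul, ih, ← hpow,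
        pow_succ]
      simp
  have := key n
  rw [← QuotientGroup.eq_one_iff, QuotientGroup.mk_mul, this, ← QuotientGroup.mk_mul]
  simp

/-- The factors of the upper central series of a torsionfree group are torsionfree. -/
lemma mem_upperCentralSeries_of_pow_mem (hA : IsTorsionfree A) (i : ℕ) :
    ∀ {x : A} {n : ℕ}, n ≠ 0 → x ∈ Subgroup.upperCentralSeries A (i + 1) →
      x ^ n ∈ Subgroup.upperCentralSeries A i → x ∈ Subgroup.upperCentralSeries A i := by
  induction i with
  | zero =>
    intro x n hn _ hxn
    rw [Subgroup.upperCentralSeries_zero, Subgroup.mem_bot] at hxn ⊢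
    exact hA x (isOfFinOrder_iff_pow_eq_one.2 ⟨n, Nat.pos_of_ne_zero hn, hxn⟩)
  | succ i ih =>
    intro x n hn hx hxn y
    have hxy : ⁅x, y⁆ ∈ Subgroup.upperCentralSeries A (i + 1) := hx y
    -- Commutation with y moves the statement one level down: the n-th power of ⁅x, y⁆ agrees with
    -- ⁅x ^ n, y⁆ modulo level i.
    refine ih hn hxy ?_
    have h1 := commutator_pow_mul_inv_mem (K := Subgroup.upperCentralSeries A i) (fun z => hxy z) n
    have h2 : ⁅x ^ n, y⁆ ∈ Subgroup.upperCentralSeries A i := hxn y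
    have := mul_mem (inv_mem h1) h2
    rwa [mul_inv_rev, inv_inv, inv_mul_cancel_right] at this

/-- The upper central series, reindexed so as to be compatible with commutators. -/
lemma isNSeries_upperCentralSeries {n : ℕ} (hn : Subgroup.upperCentralSeries A n = ⊤) :
    IsNSeries fun k => Subgroup.upperCentralSeries A (n - Nat.clog 2 k) where
  normal _ := inferInstance
  anti k l hkl := Subgroup.upperCentralSeries_mono A (by
    have := Nat.clog_mono_right 2 hkl; omega)
  one := by simpa using hn
  comm {i j x y} hx hy := by
    wlog hij : i ≤ j generalizing i j x y
    · rw [add_comm, ← commutatorElement_inv]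
      exact inv_mem (this hy hx (by omega))
    rcases Nat.eq_zero_or_pos j with rfl | hj
    · obtain rfl : i = 0 := by omega
      simp [hn]
    -- A commutator is only known to descend one step from its deeper entry. As i + j ≤ 2j, the
    -- logarithmic index asks for no more than that.
    have hlog : Nat.clog 2 (i + j) ≤ Nat.clog 2 j + 1 := by
      calc Nat.clog 2 (i + j) ≤ Nat.clog 2 (2 * j) := Nat.clog_mono_right 2 (by omega)
        _ ≤ Nat.clog 2 j + 1 := by
          refine Nat.clog_le_of_le_pow ?_
          rw [pow_succ, mul_comm]
          exact Nat.mul_le_mul_right 2 (Nat.le_pow_clog (by norm_num) j)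
    have hmono := Subgroup.upperCentralSeries_mono A
      (show n - Nat.clog 2 j - 1 ≤ n - Nat.clog 2 (i + j) by omega)
    refine hmono ?_
    rcases Nat.eq_zero_or_pos (n - Nat.clog 2 j) with h0 | h0
    · rw [h0, Subgroup.upperCentralSeries_zero, Subgroup.mem_bot] at hy
      simp [hy]
    · obtain ⟨l, hl⟩ : ∃ l, n - Nat.clog 2 j = l + 1 := ⟨_, (Nat.sub_add_cancel h0).symm⟩
      rw [hl] at hy ⊢
      rw [← commutatorElement_inv]
      exact inv_mem (hy x)

/-- The dimension subgroup of high level of a torsionfree nilpotent group is trivial. -/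
lemma dimTrivial_upperCentralSeries (hA : IsTorsionfree A) {n : ℕ}
    (hn : Subgroup.upperCentralSeries A n = ⊤) (j : ℕ) :
    DimTrivial (fun k => Subgroup.upperCentralSeries A (n - Nat.clog 2 k)) (2 ^ n)
      (Subgroup.upperCentralSeries A j) := by
  set D : ℕ → Subgroup A := fun k => Subgroup.upperCentralSeries A (n - Nat.clog 2 k) with hDdef
  have hD : IsNSeries D := isNSeries_upperCentralSeries hn
  have hDN : D (2 ^ n) = ⊥ := by simp [hDdef, Nat.clog_pow]
  induction j with
  | zero => exact fun m hm _ => by simpa using hm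
  | succ j ih =>
    intro m hm hmN
    obtain ⟨S, hS, hSH, hSN⟩ := exists_finset_mem_augFilt hmN
    set Z := Subgroup.upperCentralSeries A j with hZ
    set q := QuotientGroup.mk' Z with hq
    have hZ1 : ∀ {a}, a ∈ Subgroup.upperCentralSeries A (j + 1) →
        q a ∈ Subgroup.center (A ⧸ Z) := by
      intro a ha
      have : a ∈ Subgroup.upperCentralSeriesStep Z := ha
      rwa [Subgroup.upperCentralSeriesStep_eq_comap_center] at this
    have hZ2 : ∀ {a}, q a ∈ Subgroup.center (A ⧸ Z) →
        a ∈ Subgroup.upperCentralSeries A (j + 1) := by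
      intro a ha
      have : a ∈ Subgroup.upperCentralSeriesStep Z := by
        rwa [Subgroup.upperCentralSeriesStep_eq_comap_center]
      exact this
    -- Restricting to finitely many elements makes the central factor finitely generated, hence free
    -- abelian; m is inserted because S need not generate it.
    set K := Subgroup.closure (q '' insert m S) with hK
    have hKc : K ≤ Subgroup.center (A ⧸ Z) := by
      rw [hK, Subgroup.closure_le]
      rintro _ ⟨a, rfl | ha, rfl⟩
      · exact hZ1 hm
      · exact hZ1 (hSH ha)
    let _ : CommGroup K :=
      { (inferInstance : Group K) with
        mul_comm := fun a b => Subtype.ext (Subgroup.mem_center_iff.1 (hKc b.2) a) }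
    have : Group.FG K := by
      have hfin : (q '' insert m S).Finite := (hS.insert m).image q
      have := hfin.to_subtype
      exact Group.closure_finite_fg _
    have : IsMulTorsionFree K := by
      refine IsMulTorsionFree.of_not_isOfFinOrder fun k hk hfin => hk ?_
      obtain ⟨r, hr, hkr⟩ := isOfFinOrder_iff_pow_eq_one.1 hfin
      obtain ⟨⟨a⟩, ha⟩ := k
      refine Subtype.ext ((QuotientGroup.eq_one_iff a).2 ?_)
      refine mem_upperCentralSeries_of_pow_mem hA j hr.ne' (hZ2 (hKc ha)) ?_
      exact (QuotientGroup.eq_one_iff _).1 (congrArg Subtype.val hkr)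
    have : Module.Finite ℤ (Additive K) := Module.Finite.iff_addGroup_fg.2 inferInstance
    let e := (Module.finBasis ℤ (Additive K)).equivFun
    classical
    let f : A → Fin (Module.finrank ℤ (Additive K)) → ℤ := fun a =>
      if h : q a ∈ K then e (Additive.ofMul ⟨q a, h⟩) else 0
    have hf : ∀ {a} (h : q a ∈ K), f a = e (Additive.ofMul ⟨q a, h⟩) := fun h => dif_pos h
    have hf0 : ∀ {a}, q a ∈ K → (f a = 0 ↔ a ∈ Z) := by
      intro a h
      rw [hf h, map_eq_zero_iff e e.injective, ofMul_eq_zero, ← QuotientGroup.eq_one_iff]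
      exact Subtype.ext_iff
    have hm' : DimTrivial D (2 ^ n) (K.comap q) := by
      refine ih.of_free hD hDN _ _ f ?_ ?_ ?_ ?_
      · intro g hg h hh
        rw [hf hg, hf hh, hf (mul_mem hg hh), ← map_add, ← ofMul_mul]
        rfl
      · intro v
        obtain ⟨⟨⟨a⟩, ha⟩, hv⟩ : ∃ k : K, e (Additive.ofMul k) = v :=
          ⟨(e.symm v).toMul, e.apply_symm_apply v⟩
        exact ⟨a, ha, (hf ha).trans hv⟩
      · intro a
        constructor
        · intro ha
          have : q a ∈ K := by
            rw [show q a = 1 from (QuotientGroup.eq_one_iff a).2 ha]; exact one_mem K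
          exact ⟨this, (hf0 this).2 ha⟩
        · rintro ⟨h1, h2⟩
          exact (hf0 h1).1 h2
      -- Each `D i` is itself an upper central term: it either contains level j + 1, hence this
      -- subgroup, or lies in level j, where f vanishes.
      · intro i
        rcases Nat.lt_or_ge j (n - Nat.clog 2 i) with h | h
        · exact Or.inl fun a ha => Subgroup.upperCentralSeries_mono A h (hZ2 (hKc ha))
        · exact Or.inr fun a ha hai => (hf0 ha).2 (Subgroup.upperCentralSeries_mono A h hai)
    have hSK : ∀ a ∈ insert m S, a ∈ K.comap q := fun a ha =>
      Subgroup.subset_closure ⟨a, ha, rfl⟩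
    refine hm' m (hSK m (Set.mem_insert _ _)) (augFilt_mono ?_ _ hSN)
    exact (Subgroup.closure_le _).2 fun a ha => hSK a (Set.mem_insert_of_mem _ ha)

end UpperCentral

/-! ### Unipotent representations and stabilizers of vectors. -/

section Unipotent

/-- A representation is unipotent if it acts trivially on the layers of a finite filtration. -/
def IsUnipotent {G V : Type*} [Group G] [AddCommGroup V] [Module ℚ V]
    (ρ : Representation ℚ G V) : Prop :=
  ∃ F : ℕ → Submodule ℚ V, Antitone F ∧ F 0 = ⊤ ∧ (∃ n, F n = ⊥) ∧
    ∀ g k, ∀ v ∈ F k, ρ g v - v ∈ F (k + 1)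

lemma isUnipotent_one {G V : Type*} [Group G] [AddCommGroup V] [Module ℚ V] :
    IsUnipotent (1 : Representation ℚ G V) := by
  refine ⟨fun k => if k = 0 then ⊤ else ⊥, fun k l hkl => ?_, rfl, ⟨1, rfl⟩, fun g k v _ => ?_⟩
  · dsimp only
    split_ifs with h1 h2
    · exact le_rfl
    · omega
    · exact bot_le
    · exact le_rfl
  · simp

lemma IsUnipotent.comp {G H V : Type*} [Group G] [Group H] [AddCommGroup V] [Module ℚ V]
    {ρ : Representation ℚ G V} (hρ : IsUnipotent ρ) (f : H →* G) :
    IsUnipotent (ρ.comp f : Representation ℚ H V) := by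
  obtain ⟨F, h1, h2, h3, h4⟩ := hρ
  exact ⟨F, h1, h2, h3, fun g => h4 (f g)⟩

/-- Unipotency may be tested on a symmetric generating set. -/
lemma isUnipotent_of_closure {G V : Type*} [Group G] [AddCommGroup V] [Module ℚ V]
    {ρ : Representation ℚ G V} {S : Set G} (hS : Subgroup.closure S = ⊤)
    (hS_inv : ∀ g ∈ S, g⁻¹ ∈ S) (F : ℕ → Submodule ℚ V) (F_anti : Antitone F) (F_zero : F 0 = ⊤)
    (F_bot : ∃ n, F n = ⊥) (hF : ∀ g ∈ S, ∀ k, ∀ v ∈ F k, ρ g v - v ∈ F (k + 1)) :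
    IsUnipotent ρ := by
  refine ⟨F, F_anti, F_zero, F_bot, fun g => ?_⟩
  have hmul : ∀ g ∈ S, ∀ h, (∀ k, ∀ v ∈ F k, ρ h v - v ∈ F (k + 1)) →
      ∀ k, ∀ v ∈ F k, ρ (g * h) v - v ∈ F (k + 1) := by
    intro g hg h hh k v hv
    have hv' : ρ h v ∈ F k := by
      simpa using add_mem (F_anti (Nat.le_succ k) (hh k v hv)) hv
    have e : ρ (g * h) v - v = (ρ g (ρ h v) - ρ h v) + (ρ h v - v) := by
      rw [map_mul, Module.End.mul_apply]; abel
    rw [e]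
    exact add_mem (hF g hg k _ hv') (hh k v hv)
  have hg : g ∈ Subgroup.closure S := hS ▸ Subgroup.mem_top g
  induction hg using Subgroup.closure_induction_left with
  | one => simp
  | mul_left g hg h _ ih => exact hmul g hg h ih
  | inv_mul_cancel g hg h _ ih => exact hmul _ (hS_inv g hg) h ih

open TensorProduct in
lemma IsUnipotent.tprod {G V W : Type*} [Group G] [AddCommGroup V] [Module ℚ V]
    [AddCommGroup W] [Module ℚ W] {ρ : Representation ℚ G V} {σ : Representation ℚ G W}
    (hρ : IsUnipotent ρ) (hσ : IsUnipotent σ) : IsUnipotent (ρ.tprod σ) := by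
  obtain ⟨E, E_anti, E_zero, ⟨m, hm⟩, hE⟩ := hρ
  obtain ⟨F, F_anti, F_zero, ⟨n, hn⟩, hF⟩ := hσ
  refine ⟨fun k => Submodule.span ℚ {z | ∃ i j, k ≤ i + j ∧ ∃ v ∈ E i, ∃ w ∈ F j, z = v ⊗ₜ w},
    fun k l hkl => ?_, ?_, ⟨m + n, ?_⟩, fun g k z hz => ?_⟩
  · exact Submodule.span_mono fun z ⟨i, j, hij, h⟩ => ⟨i, j, hkl.trans hij, h⟩
  · rw [eq_top_iff, ← TensorProduct.span_tmul_eq_top]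
    refine Submodule.span_mono ?_
    rintro _ ⟨v, w, rfl⟩
    exact ⟨0, 0, le_rfl, v, by simp [E_zero], w, by simp [F_zero], rfl⟩
  · rw [Submodule.span_eq_bot]
    rintro _ ⟨i, j, hij, v, hv, w, hw, rfl⟩
    rcases le_or_gt m i with h | h
    · have := E_anti h hv
      rw [hm, Submodule.mem_bot] at this
      rw [this, TensorProduct.zero_tmul]
    · have := F_anti (show n ≤ j by omega) hw
      rw [hn, Submodule.mem_bot] at this
      rw [this, TensorProduct.tmul_zero]
  · induction hz using Submodule.span_induction with
    | zero => simp
    | add x y _ _ hx hy =>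
      rw [map_add, add_sub_add_comm]; exact add_mem hx hy
    | smul c x _ hx =>
      rw [map_smul, ← smul_sub]; exact Submodule.smul_mem _ c hx
    | mem z hz =>
      obtain ⟨i, j, hij, v, hv, w, hw, rfl⟩ := hz
      have hσw : σ g w ∈ F j := by
        simpa using add_mem (F_anti (Nat.le_succ j) (hF g j w hw)) hw
      have e : (ρ.tprod σ) g (v ⊗ₜ[ℚ] w) - v ⊗ₜ[ℚ] w
          = (ρ g v - v) ⊗ₜ[ℚ] σ g w + v ⊗ₜ[ℚ] (σ g w - w) := by
        rw [Representation.tprod_apply, TensorProduct.map_tmul, TensorProduct.sub_tmul,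
          TensorProduct.tmul_sub]
        abel
      rw [e]
      exact add_mem
        (Submodule.subset_span ⟨i + 1, j, by omega, _, hE g i v hv, _, hσw, rfl⟩)
        (Submodule.subset_span ⟨i, j + 1, by omega, _, hv, _, hF g j w hw, rfl⟩)

/-- The image of a unipotent representation is nilpotent. -/
lemma IsUnipotent.isNilpotent_quotient_ker {G V : Type*} [Group G] [AddCommGroup V] [Module ℚ V]
    {ρ : Representation ℚ G V} (hρ : IsUnipotent ρ) : Group.IsNilpotent (G ⧸ ρ.ker) := by
  obtain ⟨F, F_anti, F_zero, ⟨n, hn⟩, hF⟩ := hρ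
  have hst : ∀ g j, ∀ v ∈ F j, ρ g v ∈ F j := fun g j v hv => by
    simpa using add_mem (F_anti (Nat.le_succ j) (hF g j v hv)) hv
  -- The elements g for which ρ(g) - 1 raises filtration degree by at least k + 1.
  let H : ℕ → Subgroup G := fun k =>
    { carrier := {g | ∀ j, ∀ v ∈ F j, ρ g v - v ∈ F (j + (k + 1))}
      one_mem' := fun j v _ => by simp
      mul_mem' := fun {a b} ha hb j v hv => by
        have e : ρ (a * b) v - v = (ρ a (ρ b v) - ρ b v) + (ρ b v - v) := by
          rw [map_mul, Module.End.mul_apply]; abel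
        rw [e]
        exact add_mem (ha j _ (hst b j v hv)) (hb j v hv)
      inv_mem' := fun {a} ha j v hv => by
        have e : ρ a⁻¹ v - v = - (ρ a (ρ a⁻¹ v) - ρ a⁻¹ v) := by
          rw [← Module.End.mul_apply, ← map_mul, mul_inv_cancel, map_one, Module.End.one_apply]
          abel
        rw [e]
        exact neg_mem (ha j _ (hst a⁻¹ j v hv)) }
  have hH : Subgroup.IsDescendingCentralSeries H := by
    refine ⟨eq_top_iff.2 fun g _ j v hv => hF g j v hv, fun x k hx g j v hv => ?_⟩
    set u := ρ x⁻¹ (ρ g⁻¹ v) with hu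
    have hu' : u ∈ F j := hst _ _ _ (hst _ _ _ hv)
    have e1 : ρ ⁅x, g⁆ v = ρ x (ρ g u) := by
      simp only [hu, commutatorElement_def, map_mul, Module.End.mul_apply]
    have e2 : v = ρ g (ρ x u) := by
      simp only [hu, ← Module.End.mul_apply, ← map_mul]
      simp
    -- With v = g x u, this is the ring commutator of x - 1 and g - 1 applied to u.
    have e : ρ ⁅x, g⁆ v - v
        = (ρ x (ρ g u - u) - (ρ g u - u)) - (ρ g (ρ x u - u) - (ρ x u - u)) := by
      rw [e1]; nth_rw 1 [e2]; simp only [map_sub]; abel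
    rw [e]
    refine sub_mem (F_anti ?_ (hx _ _ (hF g j u hu'))) (F_anti ?_ (hF g _ _ (hx j u hu'))) <;>
      omega
  have hle : Subgroup.lowerCentralSeries (⊤ : Subgroup G) n ≤ ρ.ker := by
    refine (Subgroup.descending_central_series_ge_lower H hH n).trans fun g hg => ?_
    rw [MonoidHom.mem_ker]
    ext v
    have := F_anti (show n ≤ 0 + (n + 1) by omega) (hg 0 v (by simp [F_zero]))
    rw [hn, Submodule.mem_bot, sub_eq_zero] at this
    simpa using this
  rw [Subgroup.nilpotent_iff_lowerCentralSeries]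
  refine ⟨n, ?_⟩
  rw [← Subgroup.map_top_of_surjective _ (QuotientGroup.mk'_surjective ρ.ker),
    ← Subgroup.map_lowerCentralSeries, Subgroup.map_eq_bot_iff, QuotientGroup.ker_mk']
  exact hle

/-- A torsionfree nilpotent group with a retraction `σ` has a unipotent rational representation
in which the image of `σ` is the stabilizer of some vector. -/
lemma exists_isUnipotent_of_retraction.{u} {A : Type u} [Group A] (hA : IsTorsionfree A)
    (hnil : Group.IsNilpotent A) (σ : A →* A) (hσ : ∀ a, σ (σ a) = σ a) :
    ∃ (U : Type u) (_ : AddCommGroup U) (_ : Module ℚ U) (ρ : Representation ℚ A U) (e : U),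
      IsUnipotent ρ ∧ (∀ a, ρ (σ a) e = e) ∧ ∀ a, a ≠ σ a → ρ a e ≠ e := by
  obtain ⟨n, hn⟩ := hnil.nilpotent
  have hD := isNSeries_upperCentralSeries hn
  have htriv := dimTrivial_upperCentralSeries hA hn n
  set D : ℕ → Subgroup A := fun k => Subgroup.upperCentralSeries A (n - Nat.clog 2 k)
  rw [hn] at htriv
  set E := augFilt D (⊤ : Subgroup A) with hE
  have hmem : ∀ a k, ∀ y ∈ E k, gr a * y * gr (σ a)⁻¹ - y ∈ E (k + 1) := by
    intro a k y hy
    have h1 : ∀ a, a ∈ D 1 := fun a => hD.one ▸ Subgroup.mem_top a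
    have := twist_sub_mem_augFilt hD (b := a * (σ a)⁻¹) (s := σ a) (Subgroup.mem_top _) (h1 _)
      (h1 _) (fun _ _ => Subgroup.mem_top _) hy
    rwa [inv_mul_cancel_right] at this
  let τ : A → Module.End ℚ (MonoidAlgebra ℚ A) := fun a =>
    LinearMap.mulRight ℚ (gr (σ a)⁻¹) ∘ₗ LinearMap.mulLeft ℚ (gr a)
  have hτ : ∀ a, E (2 ^ n) ≤ (E (2 ^ n)).comap (τ a) := fun a y hy => by
    have := add_mem (augFilt_antitone (Nat.le_succ _) (hmem a _ y hy)) hy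
    rwa [sub_add_cancel] at this
  let ρ : Representation ℚ A (MonoidAlgebra ℚ A ⧸ E (2 ^ n)) :=
    { toFun := fun a => Submodule.mapQ _ _ (τ a) (hτ a)
      map_one' := by
        ext y; simp [τ]
      map_mul' := fun a b => by
        refine Submodule.linearMap_qext _ (LinearMap.ext fun y => ?_)
        simp [τ, mul_assoc] }
  have hρ : ∀ a y, ρ a (Submodule.Quotient.mk y)
      = Submodule.Quotient.mk (gr a * y * gr (σ a)⁻¹) := fun a y => rfl
  refine ⟨_, _, _, ρ, Submodule.Quotient.mk 1,
    ⟨fun k => (E k).map (E (2 ^ n)).mkQ, fun k l hkl => ?_,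
      ?_, ⟨2 ^ n, ?_⟩, ?_⟩, ?_, ?_⟩
  · exact Submodule.map_mono (augFilt_antitone hkl)
  · dsimp only
    rw [hE, augFilt_zero_top hD, Submodule.map_top, Submodule.range_mkQ]
  · simp
  · rintro a k _ ⟨y, hy, rfl⟩
    exact ⟨_, hmem a k y hy, rfl⟩
  · intro a
    rw [hρ, hσ, mul_one, ← map_mul, mul_inv_cancel, map_one]
  · intro a ha h
    rw [hρ, mul_one, ← map_mul, Submodule.Quotient.eq] at h
    exact ha (mul_inv_eq_one.1 (htriv _ (Subgroup.mem_top _) h))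

end Unipotent

/-! ### Alternating words and normal forms. -/

section Words

/-- Alternating words in two subsets; the flag is `true` if a letter of `P` may be prepended. -/
inductive AltWord {G : Type*} (P Q : Set G) : Bool → List G → Prop
  | nil (b : Bool) : AltWord P Q b []
  | consLeft {g : G} {l : List G} : g ∈ P → AltWord P Q true l → AltWord P Q false (g :: l)
  | consRight {g : G} {l : List G} : g ∈ Q → AltWord P Q false l → AltWord P Q true (g :: l)

lemma AltWord.swap {G : Type*} {P Q : Set G} {b : Bool} {l : List G} (h : AltWord P Q b l) : AltWord Q P (!b) l := by
  induction h with
  | nil b => exact .nil _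
  | consLeft hg _ ih => exact .consRight hg ih
  | consRight hg _ ih => exact .consLeft hg ih

lemma AltWord.mem {G : Type*} {P Q : Set G} {b : Bool} {l : List G} (h : AltWord P Q b l) : ∀ g ∈ l, g ∈ P ∪ Q := by
  induction h with
  | nil b => simp
  | consLeft hg _ ih => exact List.forall_mem_cons.2 ⟨Or.inl hg, ih⟩
  | consRight hg _ ih => exact List.forall_mem_cons.2 ⟨Or.inr hg, ih⟩

variable {G C : Type*} [Group G] [Group C] {P Q : Set G} {γ : C →* G}

lemma AltWord.exists_map_mul (hP : ∀ c, ∀ g ∈ P, γ c * g ∈ P) (hQ : ∀ c, ∀ g ∈ Q, γ c * g ∈ Q)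
    {b : Bool} {l : List G} (h : AltWord P Q b l) (c : C) :
    ∃ l' c', AltWord P Q b l' ∧ γ c * l.prod = l'.prod * γ c' := by
  cases h with
  | nil b => exact ⟨[], c, .nil b, by simp⟩
  | @consLeft g l hg hl => exact ⟨(γ c * g) :: l, 1, .consLeft (hP c g hg) hl, by simp [mul_assoc]⟩
  | @consRight g l hg hl => exact ⟨(γ c * g) :: l, 1, .consRight (hQ c g hg) hl, by simp [mul_assoc]⟩

/-- An element with an expression as an alternating word followed by an element of the image of
`γ`. -/
def HasNormalForm (P Q : Set G) (γ : C →* G) (g : G) : Prop :=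
  ∃ b l c, AltWord P Q b l ∧ g = l.prod * γ c

lemma HasNormalForm.swap {g : G} (h : HasNormalForm P Q γ g) : HasNormalForm Q P γ g := by
  obtain ⟨b, l, c, hl, rfl⟩ := h
  exact ⟨_, l, c, hl.swap, rfl⟩

lemma HasNormalForm.map_mul (hP : ∀ c, ∀ g ∈ P, γ c * g ∈ P) (hQ : ∀ c, ∀ g ∈ Q, γ c * g ∈ Q)
    {g : G} (h : HasNormalForm P Q γ g) (c : C) : HasNormalForm P Q γ (γ c * g) := by
  obtain ⟨b, l, d, hl, rfl⟩ := h
  obtain ⟨l', c', hl', e⟩ := hl.exists_map_mul hP hQ c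
  exact ⟨b, l', c' * d, hl', by rw [← mul_assoc, e, _root_.map_mul, mul_assoc]⟩

lemma HasNormalForm.left_mul (hP : ∀ c, ∀ g ∈ P, γ c * g ∈ P) (hQ : ∀ c, ∀ g ∈ Q, γ c * g ∈ Q)
    (hPP : ∀ g ∈ P, ∀ h ∈ P, g * h ∈ P ∨ ∃ c, g * h = γ c)
    {g : G} (h : HasNormalForm P Q γ g) {x : G} (hx : x ∈ P) : HasNormalForm P Q γ (x * g) := by
  obtain ⟨b, l, d, hl, rfl⟩ := h
  cases hl with
  | nil b => exact ⟨false, [x], d, .consLeft hx (.nil true), by simp⟩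
  | @consRight g l hg hl =>
    exact ⟨false, x :: g :: l, d, .consLeft hx (.consRight hg hl), by simp [mul_assoc]⟩
  | @consLeft g l hg hl =>
    rcases hPP x hx g hg with h | ⟨c, hc⟩
    · exact ⟨false, (x * g) :: l, d, .consLeft h hl, by simp [mul_assoc]⟩
    · have := HasNormalForm.map_mul hP hQ ⟨true, l, d, hl, rfl⟩ c
      rwa [← hc, ← mul_assoc, mul_assoc x, ← List.prod_cons, mul_assoc] at this

end Words

/-! ### Building detecting representations letter by letter. -/

section Tower

universe u v w x

variable {A : Type u} {B : Type v} {C : Type x} {G : Type*} [Group A] [Group B] [Group C] [Group G]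

/-- A unipotent representation of `G`, together with a projection `p` to a representation of `C`
which is equivariant for `α`, whose composite with the action on a vector detects the word `l`
but none of its proper suffixes. -/
def Detects (r : G →* C) (γ : C →* G) (α : A →* G) (l : List G) : Prop :=
  ∃ (V X : Type w) (_ : AddCommGroup V) (_ : Module ℚ V) (_ : AddCommGroup X) (_ : Module ℚ X)
    (ρ : Representation ℚ G V) (χ : Representation ℚ C X) (p : V →ₗ[ℚ] X) (v₀ : V),
    IsUnipotent ρ ∧ IsUnipotent χ ∧ (∀ a v, p (ρ (α a) v) = χ (r (α a)) (p v)) ∧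
    (∀ c, ρ (γ c) v₀ = v₀) ∧ (∀ l', l' <:+ l → l' ≠ l → p (ρ l'.prod v₀) = 0) ∧
    p (ρ l.prod v₀) ≠ 0

/-- Pairs of representations of `A` and `B` agreeing on `C` extend to `G`. -/
def HasRepLift (i : C →* A) (j : C →* B) (α : A →* G) (β : B →* G) : Prop :=
  ∀ (V : Type w) [AddCommGroup V] [Module ℚ V] (ρA : Representation ℚ A V)
    (ρB : Representation ℚ B V), (∀ c, ρA (i c) = ρB (j c)) →
    ∃ ρ : Representation ℚ G V, (∀ a, ρ (α a) = ρA a) ∧ ∀ b, ρ (β b) = ρB b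

lemma detects_nil (r : G →* C) (γ : C →* G) (α : A →* G) : Detects.{u, w} r γ α [] := by
  refine ⟨ULift ℚ, ULift ℚ, inferInstance, inferInstance, inferInstance, inferInstance, 1, 1,
    LinearMap.id, ⟨1⟩, isUnipotent_one, isUnipotent_one, fun _ _ => rfl, fun _ => rfl,
    fun l' h h' => absurd (List.suffix_nil.1 h) h', ?_⟩
  exact fun h => one_ne_zero (α := ℚ) (congrArg ULift.down h)

lemma tmul_ne_zero {U X : Type*} [AddCommGroup U] [Module ℚ U] [AddCommGroup X] [Module ℚ X]
    {u : U} {x : X} (hu : u ≠ 0) (hx : x ≠ 0) : TensorProduct.tmul ℚ u x ≠ 0 := by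
  obtain ⟨f, hf⟩ := Module.Projective.exists_dual_ne_zero ℚ hu
  obtain ⟨g, hg⟩ := Module.Projective.exists_dual_ne_zero ℚ hx
  intro h
  have := congrArg (LinearMap.mul' ℚ ℚ ∘ₗ TensorProduct.map f g) h
  simp [hf, hg] at this

open TensorProduct in
-- Prepending a letter of A trades A-equivariance of the projection for B-equivariance, ready for a
-- next letter from B.
lemma Detects.cons {i : C →* A} {j : C →* B} {α : A →* G} {β : B →* G} {r : G →* C} {γ : C →* G}
    (hαi : ∀ c, α (i c) = γ c) (hβj : ∀ c, β (j c) = γ c) (hr : ∀ c, r (γ c) = c)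
    (hlift : HasRepLift.{u, v, w} i j α β)
    (hgen : Subgroup.closure (Set.range α ∪ Set.range β) = ⊤)
    {l : List G} (hl : ∀ g ∈ l, g ∈ Set.range α ∪ Set.range β) (h : Detects.{u, w} r γ α l)
    {U : Type w} [AddCommGroup U] [Module ℚ U] {σ : Representation ℚ A U} {e : U}
    (hσ : IsUnipotent σ) (hσe : ∀ c, σ (i c) e = e) {s : A} (hs : σ s e ≠ e) :
    Detects.{v, w} r γ β (α s :: l) := by
  obtain ⟨V, X, _, _, _, _, ρ, χ, p, v₀, hρ, hχ, hp, hv₀, hp0, hp1⟩ := h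
  -- Both factors act on U ⊗ X through A × C, so one filtration serves for both.
  let θ : Representation ℚ (A × C) (U ⊗[ℚ] X) :=
    Representation.tprod (σ.comp (MonoidHom.fst A C)) (χ.comp (MonoidHom.snd A C))
  have hθ : IsUnipotent θ := (hσ.comp _).tprod (hχ.comp _)
  let θA : Representation ℚ A (U ⊗[ℚ] X) := θ.comp ((MonoidHom.id A).prod (r.comp α))
  let χ' : Representation ℚ C (U ⊗[ℚ] X) := θ.comp (i.prod (MonoidHom.id C))
  let θB : Representation ℚ B (U ⊗[ℚ] X) := χ'.comp (r.comp β)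
  have hχ' : IsUnipotent χ' := hθ.comp _
  let κ : A → V →ₗ[ℚ] U ⊗[ℚ] X := fun a =>
    TensorProduct.mk ℚ U X (σ a e - e) ∘ₗ χ (r (α a)) ∘ₗ p
  have hκ : ∀ a v, κ a v = (σ a e - e) ⊗ₜ χ (r (α a)) (p v) := fun a v => rfl
  have hθA : ∀ a u y, θA a (u ⊗ₜ y) = σ a u ⊗ₜ χ (r (α a)) y := fun a u y => rfl
  have hκmul : ∀ a b v, κ (a * b) v = κ a (ρ (α b) v) + θA a (κ b v) := by
    intro a b v
    simp only [hκ, hθA, hp, map_mul, Module.End.mul_apply, ← TensorProduct.add_tmul, map_sub]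
    congr 1; abel
  let ρA : Representation ℚ A (V × (U ⊗[ℚ] X)) :=
    { toFun := fun a => (ρ (α a) ∘ₗ LinearMap.fst ℚ _ _).prod
        (θA a ∘ₗ LinearMap.snd ℚ _ _ + κ a ∘ₗ LinearMap.fst ℚ _ _)
      map_one' := by
        refine LinearMap.ext fun y => Prod.ext ?_ ?_
        · simp
        · simp [hκ]
      map_mul' := fun a b => by
        refine LinearMap.ext fun y => Prod.ext ?_ ?_
        · simp
        · simp only [hκmul, Module.End.mul_apply, LinearMap.prod_apply, Function.prod_apply,
            LinearMap.add_apply, LinearMap.comp_apply, LinearMap.fst_apply,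
            LinearMap.snd_apply, map_mul, map_add]
          abel }
  let ρB : Representation ℚ B (V × (U ⊗[ℚ] X)) :=
    { toFun := fun b => (ρ (β b)).prodMap (θB b)
      map_one' := by simp [LinearMap.prodMap_one]
      map_mul' := fun a b => by simp [LinearMap.prodMap_mul] }
  have hρA : ∀ a y, ρA a y = (ρ (α a) y.1, θA a y.2 + κ a y.1) := fun a y => rfl
  have hρB : ∀ b y, ρB b y = (ρ (β b) y.1, θB b y.2) := fun b y => rfl
  have hκi : ∀ c v, κ (i c) v = 0 := fun c v => by simp [hκ, hσe]
  have hθi : ∀ c, θA (i c) = χ' c := fun c => by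
    simp [θA, χ', hαi, hr]
  have hθB : ∀ c, θB (j c) = χ' c := fun c => by simp [θB, hβj, hr]
  have hagree : ∀ c, ρA (i c) = ρB (j c) := fun c => LinearMap.ext fun y => by
    rw [hρA, hρB, hκi, add_zero, hθi, hθB, hαi, hβj]
  obtain ⟨ρ', hα', hβ'⟩ := hlift _ ρA ρB hagree
  -- The cocycle sees only p, which vanishes on every proper suffix, so the second coordinate is
  -- still 0 after all of l.
  have hsuff : ∀ l', l' <:+ l → ρ' l'.prod (v₀, 0) = (ρ l'.prod v₀, 0) := by
    intro l'
    induction l' with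
    | nil => intro _; simp
    | cons g l' ih =>
      intro hgl
      have hl' : l' <:+ l := (List.suffix_cons g l').trans hgl
      have hne : l' ≠ l := by
        rintro rfl
        have := hgl.length_le
        simp at this
      rw [List.prod_cons, map_mul, map_mul, Module.End.mul_apply, Module.End.mul_apply, ih hl']
      rcases hl g (hgl.subset List.mem_cons_self) with ⟨a, rfl⟩ | ⟨b, rfl⟩
      · rw [hα', hρA, hκ, hp0 l' hl' hne]; simp
      · rw [hβ', hρB]; simp
  refine ⟨V × (U ⊗[ℚ] X), U ⊗[ℚ] X, inferInstance, inferInstance, inferInstance, inferInstance,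
    ρ', χ', LinearMap.snd ℚ _ _, (v₀, 0), ?_, hχ', ?_, ?_, ?_, ?_⟩
  · obtain ⟨E, E_anti, E_zero, ⟨n, hn⟩, hE⟩ := hρ
    obtain ⟨T, T_anti, T_zero, ⟨m, hm⟩, hT⟩ := hθ
    -- Truncated subtraction keeps the second factor full until E has reached 0 at n, so the cocycle
    -- may land anywhere in U ⊗ X.
    refine isUnipotent_of_closure hgen ?_ (fun k => (E k).prod (T (k - n))) ?_ ?_ ⟨n + m, ?_⟩ ?_
    · rintro _ (⟨a, rfl⟩ | ⟨b, rfl⟩)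
      · exact Or.inl ⟨a⁻¹, map_inv α a⟩
      · exact Or.inr ⟨b⁻¹, map_inv β b⟩
    · exact fun k l hkl => Submodule.prod_mono (E_anti hkl) (T_anti (by omega))
    · simp [E_zero, T_zero]
    · have : E (n + m) = ⊥ := by rw [eq_bot_iff, ← hn]; exact E_anti (by omega)
      simp [this, hm]
    · rintro g hg k ⟨y, z⟩ ⟨hy, hz⟩
      have hTk : ∀ a c, θ (a, c) z - z ∈ T (k + 1 - n) := fun a c =>
        T_anti (by omega) (hT (a, c) _ z hz)
      rcases hg with ⟨a, rfl⟩ | ⟨b, rfl⟩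
      · rw [hα', hρA]
        refine ⟨hE _ k y hy, ?_⟩
        rw [Prod.snd_sub, add_sub_right_comm]
        refine add_mem (hTk a (r (α a))) ?_
        rcases Nat.lt_or_ge k n with hk | hk
        · rw [show k + 1 - n = 0 by omega, T_zero]
          exact Submodule.mem_top
        · have := E_anti hk hy
          rw [hn, Submodule.mem_bot] at this
          dsimp only at this
          rw [this, map_zero]
          exact zero_mem _
      · rw [hβ', hρB]
        exact ⟨hE _ k y hy, hTk _ _⟩
  · intro b y
    rw [hβ', hρB]
    rfl
  · intro c
    rw [← hαi, hα', hρA, hκi, hαi, hv₀]; simp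
  · intro l' hl' hne
    rcases List.suffix_cons_iff.1 hl' with h | h
    · exact absurd h hne
    · rw [hsuff l' h]; rfl
  · rw [List.prod_cons, map_mul, Module.End.mul_apply, hsuff l (List.suffix_refl l), hα', hρA]
    simp only [LinearMap.snd_apply, map_zero, zero_add, hκ]
    refine tmul_ne_zero (sub_ne_zero.2 hs) fun h0 => hp1 ?_
    have := congrArg (χ (r (α s))⁻¹) h0
    rwa [map_zero, ← Module.End.mul_apply, ← map_mul, inv_mul_cancel, map_one] at this

end Tower

universe u v w x

lemma IsRetract.exists_leftInverse {A C : Type*} [Group A] [Group C] {i : C →* A}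
    (hi : Function.Injective i) (h : IsRetract i.range) : ∃ r : A →* C, ∀ c, r (i c) = c := by
  obtain ⟨φ, hφ⟩ := h
  refine ⟨(MonoidHom.ofInjective hi).symm.toMonoidHom.comp φ, fun c => ?_⟩
  have : φ (i c) = MonoidHom.ofInjective hi c := hφ ⟨i c, c, rfl⟩
  simp [this]

/-- A retract of a torsionfree nilpotent group is the stabilizer of a vector in some unipotent
rational representation. -/
lemma exists_isUnipotent_stabilizer {A : Type u} {C : Type x} [Group A] [Group C]
    (hA : IsTorsionfree A) (hnil : Group.IsNilpotent A) {i : C →* A} {r : A →* C}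
    (hr : ∀ c, r (i c) = c) :
    ∃ (U : Type (max u w)) (_ : AddCommGroup U) (_ : Module ℚ U) (ρ : Representation ℚ A U) (e : U),
      IsUnipotent ρ ∧ (∀ c, ρ (i c) e = e) ∧ ∀ a, a ∉ i.range → ρ a e ≠ e := by
  -- The spaces obtained from A and from B must share a universe, since both enter the same tower.
  let up : A ≃* ULift.{w} A := MulEquiv.ulift.symm
  have htor : IsTorsionfree (ULift.{w} A) := fun g hg => by
    have h1 : up.symm g = 1 := hA _ (up.symm.toMonoidHom.isOfFinOrder hg)
    simpa using h1
  have hnil' : Group.IsNilpotent (ULift.{w} A) := Group.nilpotent_of_mulEquiv up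
  obtain ⟨U, _, _, ρ, e, hρ, he, hs⟩ := exists_isUnipotent_of_retraction htor hnil'
    (up.toMonoidHom.comp (i.comp (r.comp up.symm.toMonoidHom))) (fun a => by simp [hr])
  refine ⟨U, _, _, ρ.comp up.toMonoidHom, e, hρ.comp _, fun c => ?_, fun a ha => hs (up a) ?_⟩
  · simpa [hr] using he (up (i c))
  · intro h
    refine ha ⟨r a, ?_⟩
    have : up a = up (i (r a)) := by simpa using h
    exact (up.injective this).symm

/-! ### The amalgamated product and its normal forms. -/

section Main

variable {A : Type u} {B : Type v} {C : Type x} [Group A] [Group B] [Group C]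
  {i : C →* A} {j : C →* B}

/-- The canonical map from the first factor to the amalgamated product. -/
def inlHom (i : C →* A) (j : C →* B) : A →* AmalgamatedProduct i j :=
  (QuotientGroup.mk' _).comp Monoid.Coprod.inl

/-- The canonical map from the second factor to the amalgamated product. -/
def inrHom (i : C →* A) (j : C →* B) : B →* AmalgamatedProduct i j :=
  (QuotientGroup.mk' _).comp Monoid.Coprod.inr

lemma inlHom_apply_eq (c : C) : inlHom i j (i c) = inrHom i j (j c) := by
  have h : Monoid.Coprod.inl (i c) * (Monoid.Coprod.inr (j c))⁻¹
      ∈ Subgroup.normalClosure (amalgamRelators i j) :=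
    Subgroup.subset_normalClosure ⟨c, rfl⟩
  have := (QuotientGroup.eq_one_iff _).2 h
  rw [QuotientGroup.mk_mul, QuotientGroup.mk_inv, mul_inv_eq_one] at this
  exact this

lemma exists_lift {M : Type*} [Monoid M] (f : A →* M) (g : B →* M) (h : ∀ c, f (i c) = g (j c)) :
    ∃ φ : AmalgamatedProduct i j →* M,
      (∀ a, φ (inlHom i j a) = f a) ∧ ∀ b, φ (inrHom i j b) = g b := by
  refine ⟨QuotientGroup.lift _ (Monoid.Coprod.lift f g) (Subgroup.normalClosure_le_normal ?_),
    fun a => ?_, fun b => ?_⟩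
  · rintro _ ⟨c, rfl⟩
    change Monoid.Coprod.lift f g _ = 1
    rw [map_mul, Monoid.Coprod.lift_apply_inl, h, ← Monoid.Coprod.lift_apply_inr f g, ← map_mul,
      mul_inv_cancel, map_one]
  · exact Monoid.Coprod.lift_apply_inl f g a
  · exact Monoid.Coprod.lift_apply_inr f g b

lemma closure_range_union :
    Subgroup.closure (Set.range (inlHom i j) ∪ Set.range (inrHom i j)) = ⊤ := by
  rw [Subgroup.closure_union, ← MonoidHom.coe_range, ← MonoidHom.coe_range, Subgroup.closure_eq,
    Subgroup.closure_eq, inlHom, inrHom, MonoidHom.range_comp, MonoidHom.range_comp,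
    ← Subgroup.map_sup, Monoid.Coprod.range_inl_sup_range_inr,
    Subgroup.map_top_of_surjective _ (QuotientGroup.mk'_surjective _)]

/-- The elements of the image of `α` which come from outside the amalgamated subgroup. -/
def letters {G : Type*} [Group G] (i : C →* A) (α : A →* G) : Set G :=
  α '' {a | a ∉ i.range}

lemma map_mul_mem_letters {G : Type*} [Group G] {α : A →* G} {γ : C →* G}
    (h : ∀ c, α (i c) = γ c) (c : C) : ∀ g ∈ letters i α, γ c * g ∈ letters i α := by
  rintro _ ⟨a, ha, rfl⟩
  refine ⟨i c * a, fun h' => ha ?_, by rw [map_mul, h]⟩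
  exact (Subgroup.mul_mem_cancel_left _ (show i c ∈ i.range from ⟨c, rfl⟩)).1 h'

lemma mul_mem_letters_or {G : Type*} [Group G] {α : A →* G} {γ : C →* G}
    (h : ∀ c, α (i c) = γ c) :
    ∀ g ∈ letters i α, ∀ g' ∈ letters i α, g * g' ∈ letters i α ∨ ∃ c, g * g' = γ c := by
  rintro _ ⟨a, _, rfl⟩ _ ⟨b, _, rfl⟩
  by_cases hab : a * b ∈ i.range
  · obtain ⟨c, hc⟩ := hab
    exact Or.inr ⟨c, by rw [← h, hc, map_mul]⟩
  · exact Or.inl ⟨a * b, hab, map_mul _ _ _⟩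

lemma mem_letters_or {G : Type*} [Group G] {α : A →* G} {γ : C →* G}
    (h : ∀ c, α (i c) = γ c) (a : A) : α a ∈ letters i α ∨ ∃ c, α a = γ c := by
  by_cases ha : a ∈ i.range
  · obtain ⟨c, rfl⟩ := ha
    exact Or.inr ⟨c, h c⟩
  · exact Or.inl ⟨a, ha, rfl⟩

lemma hasNormalForm {G : Type*} [Group G] {α : A →* G} {β : B →* G} {γ : C →* G}
    (hα : ∀ c, α (i c) = γ c) (hβ : ∀ c, β (j c) = γ c)
    (hgen : Subgroup.closure (Set.range α ∪ Set.range β) = ⊤) (g : G) :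
    HasNormalForm (letters i α) (letters j β) γ g := by
  have hP := map_mul_mem_letters hα
  have hQ := map_mul_mem_letters hβ
  have hmul : ∀ x ∈ Set.range α ∪ Set.range β, ∀ g,
      HasNormalForm (letters i α) (letters j β) γ g →
        HasNormalForm (letters i α) (letters j β) γ (x * g) := by
    rintro _ (⟨a, rfl⟩ | ⟨b, rfl⟩) g hg
    · rcases mem_letters_or hα a with ha | ⟨c, hc⟩
      · exact hg.left_mul hP hQ (mul_mem_letters_or hα) ha
      · exact hc ▸ hg.map_mul hP hQ c
    · rcases mem_letters_or hβ b with hb | ⟨c, hc⟩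
      · exact (hg.swap.left_mul hQ hP (mul_mem_letters_or hβ) hb).swap
      · exact hc ▸ hg.map_mul hP hQ c
  have hg : g ∈ Subgroup.closure (Set.range α ∪ Set.range β) := hgen ▸ Subgroup.mem_top g
  induction hg using Subgroup.closure_induction_left with
  | one => exact ⟨true, [], 1, .nil _, by simp⟩
  | mul_left x hx y _ ih => exact hmul x hx y ih
  | inv_mul_cancel x hx y _ ih =>
    refine hmul _ ?_ y ih
    rcases hx with ⟨a, rfl⟩ | ⟨b, rfl⟩
    · exact Or.inl ⟨a⁻¹, map_inv α a⟩
    · exact Or.inr ⟨b⁻¹, map_inv β b⟩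

lemma AltWord.detects {G : Type*} [Group G] {α : A →* G} {β : B →* G} {γ : C →* G} {r : G →* C}
    (hA : IsTorsionfree A) (hB : IsTorsionfree B) (hA_nil : Group.IsNilpotent A)
    (hB_nil : Group.IsNilpotent B) (hα : ∀ c, α (i c) = γ c) (hβ : ∀ c, β (j c) = γ c)
    (hr : ∀ c, r (γ c) = c) (hgen : Subgroup.closure (Set.range α ∪ Set.range β) = ⊤)
    (hlift : HasRepLift.{u, v, max u v} i j α β) {b : Bool} {l : List G}
    (hl : AltWord (letters i α) (letters j β) b l) :
    if b then Detects.{u, max u v} r γ α l else Detects.{v, max u v} r γ β l := by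
  have hsub : ∀ {b l}, AltWord (letters i α) (letters j β) b l →
      ∀ g ∈ l, g ∈ Set.range α ∪ Set.range β := fun hl g hg =>
    (hl.mem g hg).imp (fun ⟨a, _, h⟩ => ⟨a, h⟩) (fun ⟨a, _, h⟩ => ⟨a, h⟩)
  have hlift' : HasRepLift.{v, u, max u v} j i β α := fun V _ _ ρB ρA h =>
    (hlift V ρA ρB fun c => (h c).symm).imp fun _ h => h.symm
  induction hl with
  | nil b =>
    cases b
    · exact detects_nil r γ β
    · exact detects_nil r γ α
  | consLeft hg hl ih =>
    obtain ⟨s, hs, rfl⟩ := hg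
    obtain ⟨U, _, _, σ, e, hσ, he, hse⟩ := exists_isUnipotent_stabilizer.{u, max u v} hA hA_nil
      (i := i) (r := r.comp α) (fun c => by simp [hα, hr])
    exact Detects.cons hα hβ hr hlift hgen (hsub hl) ih hσ he (hse s hs)
  | consRight hg hl ih =>
    obtain ⟨s, hs, rfl⟩ := hg
    obtain ⟨U, _, _, σ, e, hσ, he, hse⟩ := exists_isUnipotent_stabilizer.{v, max u v} hB hB_nil
      (i := j) (r := r.comp β) (fun c => by simp [hβ, hr])
    exact Detects.cons hβ hα hr hlift' (by rw [Set.union_comm]; exact hgen)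
      (fun g hg => (hsub hl g hg).symm) ih hσ he (hse s hs)

/-- A word detected by a unipotent representation, followed by an element of the amalgamated
subgroup, is nontrivial in some nilpotent quotient. -/
lemma Detects.exists_nilpotent_quotient {G : Type*} [Group G] {α : A →* G} {γ : C →* G}
    {r : G →* C} {l : List G} (h : Detects.{u, w} r γ α l) (hl : l ≠ []) (c : C) :
    ∃ (N : Subgroup G) (_ : N.Normal), Group.IsNilpotent (G ⧸ N) ∧
      QuotientGroup.mk' N (l.prod * γ c) ≠ 1 := by
  obtain ⟨V, X, _, _, _, _, ρ, χ, p, v₀, hρ, -, -, hv₀, hp0, hp1⟩ := h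
  refine ⟨ρ.ker, inferInstance, hρ.isNilpotent_quotient_ker, fun h1 => hp1 ?_⟩
  have hmem := (QuotientGroup.eq_one_iff _).1 h1
  rw [MonoidHom.mem_ker] at hmem
  have e := LinearMap.congr_fun hmem v₀
  rw [map_mul, Module.End.mul_apply, hv₀, Module.End.one_apply] at e
  -- If the element acted trivially, the word would fix v₀, so p would be nonzero at v₀; but the
  -- empty word is a proper suffix.
  rw [e]
  simpa using hp0 [] List.nil_suffix hl.symm

end Main

end FreeAmalgam

theorem theoremA {A B C : Type*} [Group A] [Group B] [CommGroup C]
    (i : C →* A) (j : C →* B)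
    (hi : Function.Injective i) (hj : Function.Injective j)
    (hA : FreeAmalgam.IsTorsionfree A) (hB : FreeAmalgam.IsTorsionfree B)
    (hA_nil : Group.IsNilpotent A) (hB_nil : Group.IsNilpotent B)
    (hCA : FreeAmalgam.IsRetract i.range) (hCB : FreeAmalgam.IsRetract j.range) :
    FreeAmalgam.IsResiduallyNilpotent (FreeAmalgam.AmalgamatedProduct i j) := by
  obtain ⟨rA, hrA⟩ := hCA.exists_leftInverse hi
  obtain ⟨rB, hrB⟩ := hCB.exists_leftInverse hj
  obtain ⟨r, hr, -⟩ := FreeAmalgam.exists_lift (i := i) (j := j) rA rB fun c => by rw [hrA, hrB]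
  set α := FreeAmalgam.inlHom i j
  set β := FreeAmalgam.inrHom i j
  have hα : ∀ c, α (i c) = (α.comp i) c := fun _ => rfl
  have hβ : ∀ c, β (j c) = (α.comp i) c := fun c => (FreeAmalgam.inlHom_apply_eq c).symm
  have hrγ : ∀ c, r ((α.comp i) c) = c := fun c => (hr (i c)).trans (hrA c)
  have hgen := FreeAmalgam.closure_range_union (i := i) (j := j)
  intro g hg
  obtain ⟨b, l, c, hl, rfl⟩ := FreeAmalgam.hasNormalForm hα hβ hgen g
  rcases eq_or_ne l [] with rfl | hne
  -- Empty word: g comes from C, and the quotient by the kernel of r embeds in the abelian group C.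
  · refine ⟨r.ker, inferInstance, ?_, fun h => hg ?_⟩
    · exact Group.nilpotent_of_mulEquiv (QuotientGroup.quotientKerEquivRange r).symm
    · have hmem := (QuotientGroup.eq_one_iff _).1 h
      rw [MonoidHom.mem_ker, List.prod_nil, one_mul, hrγ] at hmem
      simp [hmem]
  · have hdet := hl.detects hA hB hA_nil hB_nil hα hβ hrγ hgen
      (fun V _ _ ρA ρB h => FreeAmalgam.exists_lift ρA ρB h)
    cases b
    · exact FreeAmalgam.Detects.exists_nilpotent_quotient hdet hne c
    · exact FreeAmalgam.Detects.exists_nilpotent_quotient hdet hne c
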